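/- **Theorem (Closure properties of visibly recursive automata).** *Definitions.* A pushdown alphabet $\tilde\Sigma=\Sigma_{int}\cup\Sigma_{call}\cup\Sigma_{ret}$ is the union of three pairwise disjoint finite alphabets. The set $WM(\tilde\Sigma)$ of well-matched words is the smallest set that contains $\Sigma_{int}^*$, contains $c\,w\,r$ whenever it contains $w$ (for $c\in\Sigma_{call}$, $r\in\Sigma_{ret}$), and is closed under concatenation. A visibly recursive automaton (VRA) $\mathcal A$ over $\tilde\Sigma$ consists of a finite set $\Sigma_{proc}$ of procedural symbols, a linking function $f=\langle f_{call},f_{ret}\rangle:\Sigma_{proc}\to\Sigma_{call}\times\Sigma_{ret}$, and nondeterministic finite automata $\mathcal A^J=\langle\Sigma_{int}\cup\Sigma_{proc},Q^J,I^J,F^J,\delta^J\rangle$ (without $\varepsilon$-transitions) for $J\in\Sigma_{proc}\cup\{S\}$, with $S\notin\Sigma_{proc}$ and with pairwise disjoint state sets; $\mathcal A^S$ is the starting automaton. Put $Q=\bigcup_J Q^J$, $\delta=\bigcup_J\delta^J$ and $|\mathcal A|=|Q|+|\delta|$. A configuration is a pair $\langle q,\sigma\rangle\in Q\times Q^*$.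 A step on $a\in\Sigma_{int}$ goes from $\langle q,\sigma\rangle$ to $\langle p,\sigma\rangle$ if $(q,a,p)\in\delta$; a step on $c\in\Sigma_{call}$ goes from $\langle q,\sigma\rangle$ to $\langle i,p\sigma\rangle$ if for some $J\in\Sigma_{proc}$ we have $f_{call}(J)=c$, $(q,J,p)\in\delta$ and $i\in I^J$; a step on $r\in\Sigma_{ret}$ goes from $\langle q,p\sigma\rangle$ to $\langle p,\sigma\rangle$ if for some $J\in\Sigma_{proc}$ we have $f_{ret}(J)=r$ and $q\in F^J$. $L(\mathcal A^J)$ is the set of words $w$ on which a sequence of steps leads from some $\langle q_i,\varepsilon\rangle$, $q_i\in I^J$, to some $\langle q_f,\varepsilon\rangle$, $q_f\in F^J$; and $L(\mathcal A)=L(\mathcal A^S)$. The VRA is *codeterministic* if $L(\mathcal A^J)\cap L(\mathcal A^{J'})=\varnothing$ for all $J\ne J'$ with $f(J)=f(J')$. It is *complete* if for all $q\in Q$ and $a\in\Sigma_{int}\cup\Sigma_{proc}$ there is some $(q,a,p)\in\delta$, and $\bigcup_{f(J)=\langle c,r\rangle}L(\mathcal A^J)=WM(\tilde\Sigma)$ for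 all $c\in\Sigma_{call}$, $r\in\Sigma_{ret}$. *Statement.* There is an absolute constant $K$ such that for every pushdown alphabet $\tilde\Sigma$ and all VRAs $\mathcal A_1,\mathcal A_2$ over $\tilde\Sigma$, with $L_1=L(\mathcal A_1)$ and $L_2=L(\mathcal A_2)$, there are VRAs over $\tilde\Sigma$ accepting 1. $L_1\cdot L_2$, of size at most $K(|\mathcal A_1|+|\mathcal A_2|)$; 2. $L_1^*$, of size at most $K\max(1,|\mathcal A_1|)$; 3. $L_1\cup L_2$, of size at most $K(|\mathcal A_1|+|\mathcal A_2|)$; 4. $L_1\cap L_2$, of size at most $K\,|\mathcal A_1|\,|\mathcal A_2|$. Moreover, for every pushdown alphabet $\tilde\Sigma$ there is a constant $K$ such that for every VRA $\mathcal A_1$ over $\tilde\Sigma$ there is a VRA $\mathcal B$ over $\tilde\Sigma$ with 5. $L(\mathcal B)=WM(\tilde\Sigma)\setminus L(\mathcal A_1)$ and $|\mathcal B|\le 2^{K\max(1,|\mathcal A_1|)}$. Here $\mathcal B$ can be chosen as the VRA that is obtained, by exchanging the final and the non-final states of the starting automaton, from a codeterministic complete VRA $\mathcal D$ with $L(\mathcal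 D)=L(\mathcal A_1)$ all of whose automata (the starting one included) are deterministic, i.e. have exactly one initial state and at most one transition from each state on each symbol. -/

import Mathlib

open Computability

universe u

/-- The symbols of a pushdown alphabet: the disjoint union of the internal symbols `I`,
the call symbols `C` and the return symbols `R`. -/
inductive PSym (I C R : Type u) : Type u
  | int (a : I)
  | call (c : C)
  | ret (r : R)

/-- Well-matched words over a pushdown alphabet. -/
inductive WellMatched {I C R : Type u} : List (PSym I C R) → Prop
  | internal (u : List I) : WellMatched (u.map PSym.int)
  | nest (c : C) (r : R) (w : List (PSym I C R)) (h : WellMatched w) :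
      WellMatched (PSym.call c :: (w ++ [PSym.ret r]))
  | append (w₁ w₂ : List (PSym I C R)) (h₁ : WellMatched w₁) (h₂ : WellMatched w₂) :
      WellMatched (w₁ ++ w₂)

/-- The language of all well-matched words. -/
def WM (I C R : Type u) : Language (PSym I C R) := {w | WellMatched w}

/-- A visibly recursive automaton over the pushdown alphabet with internal symbols `I`, call
symbols `C` and return symbols `R`: a finite set `Proc` of procedural symbols, a linking function,
and one finite automaton over `I ⊕ Proc` for each index in `Option Proc`. The index `none` is the
starting automaton `S`, the index `some J` is the automaton of the procedural symbol `J`. -/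
structure VRA (I C R : Type u) where
  Proc : Type u
  finite_proc : Finite Proc
  link : Proc → C × R
  State : Option Proc → Type u
  finite_state : ∀ J, Finite (State J)
  aut : ∀ J : Option Proc, NFA (I ⊕ Proc) (State J)

attribute [instance] VRA.finite_proc VRA.finite_state

namespace VRA

variable {I C R : Type u}

/-- All states of a VRA: the disjoint union of the state sets of its automata. -/
abbrev States (A : VRA I C R) : Type u := Σ J : Option A.Proc, A.State J

/-- All transitions of a VRA. -/
def trans (A : VRA I C R) : Set (A.States × (I ⊕ A.Proc) × A.States) :=
  {t | ∃ (J : Option A.Proc) (q : A.State J) (a : I ⊕ A.Proc) (p : A.State J),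
    p ∈ (A.aut J).step q a ∧ t = (⟨J, q⟩, a, ⟨J, p⟩)}

/-- The size of a VRA: the number of states plus the number of transitions. -/
noncomputable def size (A : VRA I C R) : ℕ := Nat.card A.States + A.trans.ncard

/-- Configurations: a current state and a stack word of states, with its top at the head. -/
abbrev Config (A : VRA I C R) : Type u := A.States × List A.States

/-- One step of a recursive run. -/
inductive Step (A : VRA I C R) : A.Config → PSym I C R → A.Config → Prop
  | int (q p : A.States) (a : I) (σ : List A.States) (h : (q, Sum.inl a, p) ∈ A.trans) :
      Step A (q, σ) (PSym.int a) (p, σ)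
  | call (q p : A.States) (J : A.Proc) (i : A.State (some J)) (σ : List A.States)
      (h : (q, Sum.inr J, p) ∈ A.trans) (hi : i ∈ (A.aut (some J)).start) :
      Step A (q, σ) (PSym.call (A.link J).1) (⟨some J, i⟩, p :: σ)
  | ret (J : A.Proc) (f : A.State (some J)) (p : A.States) (σ : List A.States)
      (hf : f ∈ (A.aut (some J)).accept) :
      Step A (⟨some J, f⟩, p :: σ) (PSym.ret (A.link J).2) (p, σ)

/-- `A.Run x w y`: there is a recursive run of `A` on the word `w` from `x` to `y`. -/
inductive Run (A : VRA I C R) : A.Config → List (PSym I C R) → A.Config → Prop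
  | nil (x : A.Config) : Run A x [] x
  | cons (x y z : A.Config) (a : PSym I C R) (w : List (PSym I C R))
      (h : Step A x a y) (hw : Run A y w z) : Run A x (a :: w) z

/-- The recursive language of the automaton with index `J`. -/
def langOf (A : VRA I C R) (J : Option A.Proc) : Language (PSym I C R) :=
  {w | ∃ qi ∈ (A.aut J).start, ∃ qf ∈ (A.aut J).accept,
    A.Run (⟨J, qi⟩, []) w (⟨J, qf⟩, [])}

/-- The language of a VRA: the recursive language of its starting automaton. -/
def lang (A : VRA I C R) : Language (PSym I C R) := A.langOf none

/-- All automata linked to the same call and return symbols have disjoint languages. -/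
def Codeterministic (A : VRA I C R) : Prop :=
  ∀ (c : C) (r : R) (J J' : A.Proc), A.link J = (c, r) → A.link J' = (c, r) → J ≠ J' →
    A.langOf (some J) ⊓ A.langOf (some J') = ⊥

/-- All automata are complete, and for all call and return symbols the languages of the automata
linked to them cover all well-matched words. -/
def Complete (A : VRA I C R) : Prop :=
  (∀ (q : A.States) (a : I ⊕ A.Proc), ∃ p : A.States, (q, a, p) ∈ A.trans) ∧
  ∀ (c : C) (r : R), (⨆ J ∈ {J : A.Proc | A.link J = (c, r)}, A.langOf (some J)) = WM I C R

/-- Every automaton of the VRA, the starting one included, is a DFA: it has exactly one initial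
state, and at most one transition from each state on each symbol. -/
def AllDFA (A : VRA I C R) : Prop :=
  ∀ J : Option A.Proc, (∃ q, (A.aut J).start = {q}) ∧
    ∀ (q : A.State J) (a : I ⊕ A.Proc), ((A.aut J).step q a).Subsingleton

/-- The VRA obtained by exchanging the final and the non-final states of the starting automaton;
nothing else is changed. -/
def flipStart (A : VRA I C R) : VRA I C R where
  Proc := A.Proc
  finite_proc := A.finite_proc
  link := A.link
  State := A.State
  finite_state := A.finite_state
  aut
    | none => { A.aut none with accept := (A.aut none).acceptᶜ }
    | some J => A.aut (some J)

end VRA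

/-!
Runs with a stack are first replaced by the stack-free relation `VRA.Path` (`VRA.run_iff_path`): a
transition on a procedural symbol reads a call, a word of the language of that symbol, and the
matching return. The matching return is determined by the word alone
(`WellMatched.append_ret_inj`), so that a path can be taken apart along the unique decomposition of
the well-matched word that it reads (`VRA.path_call_iff`).

*Concatenation, star and union.* The language of a VRA is obtained from the regular language of its
starting automaton by substituting, for every procedural symbol, the language of its automaton
(`VRA.langOf_eq_substLang`). Substitution commutes with the three operations, so it suffices to keep
all procedural automata and to build a new starting automaton (`VRA.withStart`) by an operation on
NFAs. As there are no `ε`-transitions, a linear size is reached by leading all transitions between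
two factors through one additional state (`NFA.concat`, `NFA.star`).

*Intersection.* Two runs on the same word call and return at the same positions, so the product
automata, with pairs of procedural symbols of equal link, accept the intersection
(`VRA.lang_inter`).

*Complement.* In `VRA.determinize` every automaton is a subset automaton on the sets of states of
the given VRA. A procedural symbol is a link `(c, r)` together with a set `U` of states, and its
language is the set of the well-matched words that lead from the initial states of all automata
linked to `(c, r)` exactly to the set `U`. For a fixed link these languages partition the
well-matched words, hence the new VRA is codeterministic and complete, and `U` tells which
procedural symbols of the given VRA accept the word in question, hence the subset construction is
correct (`VRA.path_determinize_iff`). Every well-matched word is read by exactly one run of the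
starting automaton, so exchanging its final and non-final states complements the language.
-/

/-! ### Well-matched words -/

namespace WellMatched

variable {I C R : Type u}

theorem nil : WellMatched ([] : List (PSym I C R)) :=
  internal []

theorem int_cons (a : I) {w : List (PSym I C R)} (h : WellMatched w) :
    WellMatched (PSym.int a :: w) :=
  append [PSym.int a] w (internal [a]) h

theorem call_cons (c : C) (r : R) {u w : List (PSym I C R)} (hu : WellMatched u)
    (hw : WellMatched w) : WellMatched (PSym.call c :: (u ++ PSym.ret r :: w)) := by
  simpa using append _ w (nest c r u hu) hw

/-- Every well-matched word is read from left to right in exactly one of three ways: it is empty,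
it starts with an internal symbol, or it starts with a call symbol, which is followed by a
well-matched word, a return symbol and a well-matched word. -/
theorem leftInduction {motive : ∀ w : List (PSym I C R), WellMatched w → Prop}
    (nil : motive [] .nil)
    (int : ∀ a w (hw : WellMatched w), motive w hw → motive (PSym.int a :: w) (hw.int_cons a))
    (call : ∀ c r u w (hu : WellMatched u) (hw : WellMatched w), motive u hu → motive w hw →
      motive (PSym.call c :: (u ++ PSym.ret r :: w)) (hu.call_cons c r hw))
    {w : List (PSym I C R)} (h : WellMatched w) : motive w h := by
  -- A statement about `w ++ v` makes the induction go through for concatenations.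
  suffices H : ∀ v (hv : WellMatched v), motive v hv → motive (w ++ v) (append _ _ h hv) by
    simpa using H [] WellMatched.nil nil
  induction h with
  | internal l =>
    intro v hv mv
    induction l with
    | nil => simpa using mv
    | cons a l ih => exact int a _ (append _ _ (internal l) hv) ih
  | nest c r u hu ih =>
    intro v hv mv
    simpa using call c r u v hu hv (by simpa using ih [] WellMatched.nil nil) mv
  | append w₁ w₂ h₁ h₂ ih₁ ih₂ =>
    intro v hv mv
    simpa using ih₁ (w₂ ++ v) (append _ _ h₂ hv) (ih₂ v hv mv)

/-- The return symbol that matches a pending call is determined by the word: no well-matched word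
followed by a return symbol is a proper prefix of another one. -/
theorem append_ret_inj {u u' : List (PSym I C R)} (hu : WellMatched u) (hu' : WellMatched u')
    {r r' : R} {w w' : List (PSym I C R)} (h : u ++ PSym.ret r :: w = u' ++ PSym.ret r' :: w') :
    u = u' ∧ r = r' ∧ w = w' := by
  induction hu using leftInduction generalizing u' r r' w w' with
  | nil =>
    induction hu' using leftInduction with
    | nil => simpa using h
    | int => simp at h
    | call => simp at h
  | int a v _ ih =>
    induction hu' using leftInduction with
    | nil => simp at h
    | int a' v' hv' _ =>
      simp only [List.cons_append, List.cons.injEq, PSym.int.injEq] at h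
      obtain ⟨rfl, h⟩ := h
      simpa using ih hv' h
    | call => simp at h
  | call c s v₁ v₂ _ _ ih₁ ih₂ =>
    induction hu' using leftInduction with
    | nil => simp at h
    | int => simp at h
    | call c' s' v₁' v₂' hv₁' hv₂' _ _ =>
      simp only [List.cons_append, List.append_assoc, List.cons.injEq, PSym.call.injEq] at h
      obtain ⟨rfl, h⟩ := h
      obtain ⟨rfl, rfl, hw⟩ := ih₁ hv₁' h
      obtain ⟨rfl, rfl, rfl⟩ := ih₂ hv₂' hw
      simp

end WellMatched

/-! ### Stack-free semantics -/

namespace VRA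

variable {I C R : Type u} {A : VRA I C R}

theorem mem_trans_iff {J K : Option A.Proc} {q : A.State J} {p : A.State K} {a : I ⊕ A.Proc} :
    ((⟨J, q⟩, a, ⟨K, p⟩) : A.States × (I ⊕ A.Proc) × A.States) ∈ A.trans ↔
      ∃ h : J = K, p ∈ (A.aut K).step (h ▸ q) a := by
  constructor
  · rintro ⟨J', q', a', p', h, e⟩
    cases e
    exact ⟨rfl, h⟩
  · rintro ⟨rfl, h⟩
    exact ⟨J, q, a, p, h, rfl⟩

theorem mem_trans_self {J : Option A.Proc} {q p : A.State J} {a : I ⊕ A.Proc} :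
    ((⟨J, q⟩, a, ⟨J, p⟩) : A.States × (I ⊕ A.Proc) × A.States) ∈ A.trans ↔
      p ∈ (A.aut J).step q a := by
  simp [mem_trans_iff]

/-- `A.Path q w p`: the word `w` can be read from the state `q` to the state `p` within a single
automaton of `A`, where a transition on a procedural symbol `J` reads `c u r`, with `(c, r)` the
link of `J` and `u` a word that leads from an initial to a final state of the automaton of `J`.
This is the stack-free counterpart of `VRA.Run`. -/
inductive Path (A : VRA I C R) : A.States → List (PSym I C R) → A.States → Prop
  | nil (q : A.States) : Path A q [] q
  | int {q p s : A.States} {a : I} {w : List (PSym I C R)} (h : (q, Sum.inl a, p) ∈ A.trans)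
      (hw : Path A p w s) : Path A q (PSym.int a :: w) s
  | proc {q p s : A.States} {J : A.Proc} {i f : A.State (some J)} {u w : List (PSym I C R)}
      (h : (q, Sum.inr J, p) ∈ A.trans) (hi : i ∈ (A.aut (some J)).start)
      (hf : f ∈ (A.aut (some J)).accept) (hu : Path A ⟨some J, i⟩ u ⟨some J, f⟩)
      (hw : Path A p w s) :
      Path A q (PSym.call (A.link J).1 :: (u ++ PSym.ret (A.link J).2 :: w)) s

theorem fst_eq_of_mem_trans {q p : A.States} {a : I ⊕ A.Proc} (h : (q, a, p) ∈ A.trans) :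
    q.1 = p.1 := by
  obtain ⟨J, q', a', p', -, e⟩ := h
  cases e
  rfl

theorem Path.fst_eq {q p : A.States} {w : List (PSym I C R)} (h : A.Path q w p) : q.1 = p.1 := by
  induction h with
  | nil => rfl
  | int h _ ih => exact (fst_eq_of_mem_trans h).trans ih
  | proc h _ _ _ _ _ ih => exact (fst_eq_of_mem_trans h).trans ih

theorem Path.wellMatched {q p : A.States} {w : List (PSym I C R)} (h : A.Path q w p) :
    WellMatched w := by
  induction h with
  | nil => exact .nil
  | int _ _ ih => exact ih.int_cons _
  | proc _ _ _ _ _ ih₁ ih₂ => exact ih₁.call_cons _ _ ih₂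

theorem Run.append {x y z : A.Config} {v w : List (PSym I C R)} (h₁ : A.Run x v y)
    (h₂ : A.Run y w z) : A.Run x (v ++ w) z := by
  induction h₁ with
  | nil => exact h₂
  | cons x y _ a v h _ ih => exact .cons _ _ _ a _ h (ih h₂)

theorem Path.run {q p : A.States} {w : List (PSym I C R)} (h : A.Path q w p) (σ : List A.States) :
    A.Run (q, σ) w (p, σ) := by
  induction h generalizing σ with
  | nil => exact .nil _
  | int h _ ih => exact .cons _ _ _ _ _ (.int _ _ _ _ h) (ih σ)
  | proc h hi hf _ _ ih₁ ih₂ =>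
    exact .cons _ _ _ _ _ (.call _ _ _ _ _ h hi)
      ((ih₁ _).append (.cons _ _ _ _ _ (.ret _ _ _ _ hf) (ih₂ σ)))

/-- `A.Unwind s q σ w`: from the configuration `⟨q, σ⟩`, the word `w` splits into a path to a final
state, the matching return symbol, and so on for every state on the stack `σ`, and ends with a path
to `s`. -/
def Unwind (A : VRA I C R) (s : A.States) :
    A.States → List A.States → List (PSym I C R) → Prop
  | q, [], w => A.Path q w s
  | q, p :: σ, w => ∃ (J : A.Proc) (f : A.State (some J)) (u v : List (PSym I C R)),
      f ∈ (A.aut (some J)).accept ∧ A.Path q u ⟨some J, f⟩ ∧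
      w = u ++ PSym.ret (A.link J).2 :: v ∧ A.Unwind s p σ v

theorem Unwind.cons {s : A.States} {x y : A.Config} {a : PSym I C R} {w : List (PSym I C R)}
    (hs : A.Step x a y) (h : A.Unwind s y.1 y.2 w) : A.Unwind s x.1 x.2 (a :: w) := by
  cases hs with
  | int q p a σ ht =>
    cases σ with
    | nil => exact Path.int ht h
    | cons t σ =>
      obtain ⟨J, f, u, v, hf, hu, rfl, hv⟩ := h
      exact ⟨J, f, _, v, hf, Path.int ht hu, rfl, hv⟩
  | call q p J i σ ht hi =>
    obtain ⟨J', f, u, v, hf, hu, rfl, hv⟩ := h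
    -- A path stays within one automaton, so the return matches the procedural symbol called.
    obtain rfl : J = J' := Option.some.inj hu.fst_eq
    cases σ with
    | nil => exact Path.proc ht hi hf hu hv
    | cons t σ =>
      obtain ⟨J', f', u', v', hf', hu', rfl, hv'⟩ := hv
      exact ⟨J', f', _, v', hf', Path.proc ht hi hf hu hu', by simp, hv'⟩
  | ret J f p σ hf => exact ⟨J, f, [], w, hf, .nil _, rfl, h⟩

theorem Run.unwind {x y : A.Config} {w : List (PSym I C R)} (h : A.Run x w y) (hy : y.2 = []) :
    A.Unwind y.1 x.1 x.2 w := by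
  induction h with
  | nil x =>
    rw [hy]
    exact .nil _
  | cons x y z a w hs _ ih => exact .cons hs (ih hy)

theorem run_iff_path {q p : A.States} {w : List (PSym I C R)} :
    A.Run (q, []) w (p, []) ↔ A.Path q w p :=
  ⟨fun h => h.unwind rfl, fun h => h.run []⟩

theorem mem_langOf {J : Option A.Proc} {w : List (PSym I C R)} :
    w ∈ A.langOf J ↔ ∃ i ∈ (A.aut J).start, ∃ f ∈ (A.aut J).accept,
      A.Path ⟨J, i⟩ w ⟨J, f⟩ := by
  simp only [← run_iff_path]
  rfl

theorem wellMatched_of_mem_langOf {J : Option A.Proc} {w : List (PSym I C R)}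
    (h : w ∈ A.langOf J) : WellMatched w := by
  obtain ⟨_, _, _, _, h⟩ := mem_langOf.1 h
  exact h.wellMatched

theorem path_nil_iff {q p : A.States} : A.Path q [] p ↔ q = p :=
  ⟨fun h => by cases h; rfl, fun h => h ▸ .nil q⟩

theorem path_int_iff {q s : A.States} {a : I} {w : List (PSym I C R)} :
    A.Path q (PSym.int a :: w) s ↔ ∃ p, (q, Sum.inl a, p) ∈ A.trans ∧ A.Path p w s := by
  constructor
  · intro h
    cases h with
    | int h hw => exact ⟨_, h, hw⟩
  · rintro ⟨p, h, hw⟩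
    exact .int h hw

/-- A path on `c u r w` with `u` well-matched takes a transition on a procedural symbol linked to
`(c, r)` whose language contains `u`, because the return that matches `c` is unique. -/
theorem path_call_iff {q s : A.States} {c : C} {r : R} {u w : List (PSym I C R)}
    (hu : WellMatched u) :
    A.Path q (PSym.call c :: (u ++ PSym.ret r :: w)) s ↔
      ∃ (J : A.Proc) (p : A.States), A.link J = (c, r) ∧ (q, Sum.inr J, p) ∈ A.trans ∧
        u ∈ A.langOf (some J) ∧ A.Path p w s := by
  constructor
  · generalize hx : PSym.call c :: (u ++ PSym.ret r :: w) = x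
    intro h
    cases h with
    | nil => cases hx
    | int => cases hx
    | @proc _ p _ J i f u' w' ht hi hf hu' hw =>
      simp only [List.cons.injEq, PSym.call.injEq] at hx
      obtain ⟨rfl, hx⟩ := hx
      obtain ⟨rfl, rfl, rfl⟩ := hu.append_ret_inj hu'.wellMatched hx
      exact ⟨J, p, rfl, ht, mem_langOf.2 ⟨i, hi, f, hf, hu'⟩, hw⟩
  · rintro ⟨J, p, hJ, ht, hu', hw⟩
    obtain ⟨i, hi, f, hf, hu'⟩ := mem_langOf.1 hu'
    have := Path.proc ht hi hf hu' hw
    rwa [hJ] at this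

end VRA

namespace VRA

variable {I C R : Type u}

/-! ### Intersection -/

section Inter

variable (A₁ A₂ : VRA I C R)

/-- The procedural symbols of the product: the pairs of procedural symbols with the same link. -/
abbrev InterProc : Type u := {P : A₁.Proc × A₂.Proc // A₁.link P.1 = A₂.link P.2}

variable {A₁ A₂} in
/-- The first component of an index of the product. -/
abbrev interFst : Option (InterProc A₁ A₂) → Option A₁.Proc := Option.map fun P => P.1.1

variable {A₁ A₂} in
/-- The second component of an index of the product. -/
abbrev interSnd : Option (InterProc A₁ A₂) → Option A₂.Proc := Option.map fun P => P.1.2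

/-- The product of two VRAs: its automata are the products of the two starting automata and of the
automata of two procedural symbols with the same link. -/
def inter : VRA I C R where
  Proc := InterProc A₁ A₂
  finite_proc := inferInstance
  link P := A₁.link P.1.1
  State J := A₁.State (interFst J) × A₂.State (interSnd J)
  finite_state _ := inferInstance
  aut J :=
    { step := fun q a => (A₁.aut (interFst J)).step q.1 (a.map id fun P => P.1.1) ×ˢ
        (A₂.aut (interSnd J)).step q.2 (a.map id fun P => P.1.2)
      start := (A₁.aut (interFst J)).start ×ˢ (A₂.aut (interSnd J)).start
      accept := (A₁.aut (interFst J)).accept ×ˢ (A₂.aut (interSnd J)).accept }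

variable {A₁ A₂}

/-- The first component of a state of the product. -/
def interStateFst (x : (inter A₁ A₂).States) : A₁.States := ⟨interFst x.1, x.2.1⟩

/-- The second component of a state of the product. -/
def interStateSnd (x : (inter A₁ A₂).States) : A₂.States := ⟨interSnd x.1, x.2.2⟩

theorem interState_injective :
    Function.Injective fun x : (inter A₁ A₂).States => (interStateFst x, interStateSnd x) := by
  rintro ⟨J, q₁, q₂⟩ ⟨J', q₁', q₂'⟩ h
  simp only [interStateFst, interStateSnd, Prod.mk.injEq, Sigma.mk.injEq] at h
  obtain ⟨⟨h₁, h₁'⟩, h₂, h₂'⟩ := h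
  obtain rfl : J = J' := by
    match J, J', h₁, h₂ with
    | none, none, _, _ => rfl
    | some P, some P', h₁, h₂ =>
      exact congrArg some
        (Subtype.ext (Prod.ext (Option.some.inj h₁) (Option.some.inj h₂)))
  cases h₁'
  cases h₂'
  rfl

theorem interLabel_injective :
    Function.Injective fun a : I ⊕ InterProc A₁ A₂ =>
      (a.map id fun P => P.1.1, a.map id fun P => P.1.2) := by
  rintro (a | P) (a' | P') h <;> simp_all [Subtype.ext_iff, Prod.ext_iff]

theorem fst_mem_trans {x y : (inter A₁ A₂).States} {a : I ⊕ InterProc A₁ A₂}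
    (h : (x, a, y) ∈ (inter A₁ A₂).trans) :
    (interStateFst x, a.map id fun P => P.1.1, interStateFst y) ∈ A₁.trans := by
  obtain ⟨J, q, a, p, h, e⟩ := h
  cases e
  exact mem_trans_self.2 h.1

theorem snd_mem_trans {x y : (inter A₁ A₂).States} {a : I ⊕ InterProc A₁ A₂}
    (h : (x, a, y) ∈ (inter A₁ A₂).trans) :
    (interStateSnd x, a.map id fun P => P.1.2, interStateSnd y) ∈ A₂.trans := by
  obtain ⟨J, q, a, p, h, e⟩ := h
  cases e
  exact mem_trans_self.2 h.2

theorem exists_mem_inter_trans {x : (inter A₁ A₂).States} {a : I ⊕ InterProc A₁ A₂}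
    {p₁ : A₁.States} {p₂ : A₂.States}
    (h₁ : (interStateFst x, a.map id fun P => P.1.1, p₁) ∈ A₁.trans)
    (h₂ : (interStateSnd x, a.map id fun P => P.1.2, p₂) ∈ A₂.trans) :
    ∃ y, (x, a, y) ∈ (inter A₁ A₂).trans ∧ interStateFst y = p₁ ∧ interStateSnd y = p₂ := by
  obtain ⟨J, q₁, q₂⟩ := x
  obtain ⟨J₁, p₁⟩ := p₁
  obtain ⟨J₂, p₂⟩ := p₂
  obtain ⟨rfl, h₁⟩ := mem_trans_iff.1 h₁
  obtain ⟨rfl, h₂⟩ := mem_trans_iff.1 h₂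
  exact ⟨⟨J, p₁, p₂⟩, mem_trans_self.2 ⟨h₁, h₂⟩, rfl, rfl⟩

theorem Path.interFst {x y : (inter A₁ A₂).States} {w : List (PSym I C R)}
    (h : (inter A₁ A₂).Path x w y) : A₁.Path (interStateFst x) w (interStateFst y) := by
  induction h with
  | nil => exact .nil _
  | int h _ ih => exact .int (fst_mem_trans h) ih
  | proc h hi hf _ _ ih₁ ih₂ => exact .proc (fst_mem_trans h) hi.1 hf.1 ih₁ ih₂

theorem Path.interSnd {x y : (inter A₁ A₂).States} {w : List (PSym I C R)}
    (h : (inter A₁ A₂).Path x w y) : A₂.Path (interStateSnd x) w (interStateSnd y) := by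
  induction h with
  | nil => exact .nil _
  | int h _ ih => exact .int (snd_mem_trans h) ih
  | @proc _ _ _ P _ _ _ _ h hi hf _ _ ih₁ ih₂ =>
    have := Path.proc (snd_mem_trans h) hi.2 hf.2 ih₁ ih₂
    rwa [← P.2] at this

/-- Two paths on the same word combine to a path of the product: they call and return at the same
positions, hence the procedural symbols that they use for a call have the same link. -/
theorem Path.inter {q₁ p₁ : A₁.States} {w : List (PSym I C R)} (h₁ : A₁.Path q₁ w p₁)
    {q₂ p₂ : A₂.States} (h₂ : A₂.Path q₂ w p₂) {x : (inter A₁ A₂).States}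
    (hx₁ : interStateFst x = q₁) (hx₂ : interStateSnd x = q₂) :
    ∃ y, (A₁.inter A₂).Path x w y ∧ interStateFst y = p₁ ∧ interStateSnd y = p₂ := by
  induction h₁ generalizing q₂ p₂ x with
  | nil =>
    obtain rfl := path_nil_iff.1 h₂
    exact ⟨x, .nil x, hx₁, hx₂⟩
  | int h _ ih =>
    obtain ⟨p, h', hw'⟩ := path_int_iff.1 h₂
    subst hx₁ hx₂
    obtain ⟨y, hy, hy₁, hy₂⟩ := exists_mem_inter_trans (a := Sum.inl _) h h'
    obtain ⟨z, hz, hz'⟩ := ih hw' hy₁ hy₂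
    exact ⟨z, .int hy hz, hz'⟩
  | @proc _ _ _ J i f _ _ h hi hf hu _ ih₁ ih₂ =>
    obtain ⟨J', p, hJ, h', hu', hw'⟩ := (path_call_iff hu.wellMatched).1 h₂
    obtain ⟨i', hi', f', hf', hu'⟩ := mem_langOf.1 hu'
    subst hx₁ hx₂
    let P : InterProc A₁ A₂ := ⟨(J, J'), hJ.symm⟩
    obtain ⟨y, hy, hy₁, hy₂⟩ := exists_mem_inter_trans (a := Sum.inr P) h h'
    obtain ⟨⟨K, g, g'⟩, hg, hg₁, hg₂⟩ := ih₁ hu' (x := ⟨some P, i, i'⟩) rfl rfl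
    obtain rfl : some P = K := hg.fst_eq
    cases hg₁
    cases hg₂
    obtain ⟨z, hz, hz'⟩ := ih₂ hw' hy₁ hy₂
    exact ⟨z, Path.proc (A := A₁.inter A₂) (J := P) (i := (i, i')) (f := (g, g')) hy ⟨hi, hi'⟩
      ⟨hf, hf'⟩ hg hz, hz'⟩

theorem lang_inter : (inter A₁ A₂).lang = A₁.lang ⊓ A₂.lang := by
  ext w
  rw [Language.mem_inf]
  constructor
  · intro h
    obtain ⟨⟨i₁, i₂⟩, hi, ⟨f₁, f₂⟩, hf, h⟩ := mem_langOf.1 h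
    exact ⟨mem_langOf.2 ⟨i₁, hi.1, f₁, hf.1, h.interFst⟩,
      mem_langOf.2 ⟨i₂, hi.2, f₂, hf.2, h.interSnd⟩⟩
  · rintro ⟨h₁, h₂⟩
    obtain ⟨i₁, hi₁, f₁, hf₁, h₁⟩ := mem_langOf.1 h₁
    obtain ⟨i₂, hi₂, f₂, hf₂, h₂⟩ := mem_langOf.1 h₂
    obtain ⟨⟨K, g, g'⟩, hg, hg₁, hg₂⟩ := h₁.inter h₂ (x := ⟨none, i₁, i₂⟩) rfl rfl
    obtain rfl : none = K := hg.fst_eq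
    cases hg₁
    cases hg₂
    exact mem_langOf.2 ⟨(i₁, i₂), ⟨hi₁, hi₂⟩, (g, g'), ⟨hf₁, hf₂⟩, hg⟩

theorem size_inter_le [Finite I] : (inter A₁ A₂).size ≤ A₁.size * A₂.size := by
  have hs : Nat.card (inter A₁ A₂).States ≤ Nat.card A₁.States * Nat.card A₂.States := by
    rw [← Nat.card_prod]
    exact Nat.card_le_card_of_injective _ interState_injective
  have ht : (inter A₁ A₂).trans.ncard ≤ A₁.trans.ncard * A₂.trans.ncard := by
    rw [← Set.ncard_prod]
    refine Set.ncard_le_ncard_of_injOn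
      (fun t => ((interStateFst t.1, t.2.1.map id fun P : InterProc A₁ A₂ => P.1.1,
          interStateFst t.2.2),
        (interStateSnd t.1, t.2.1.map id fun P : InterProc A₁ A₂ => P.1.2,
          interStateSnd t.2.2)))
      (fun t ht => ⟨fst_mem_trans ht, snd_mem_trans ht⟩) ?_ (Set.toFinite _)
    rintro ⟨x, a, y⟩ - ⟨x', a', y'⟩ - h
    simp only [Prod.mk.injEq] at h
    obtain ⟨⟨hx, ha, hy⟩, hx', ha', hy'⟩ := h
    exact Prod.ext (interState_injective (Prod.ext hx hx'))
      (Prod.ext (interLabel_injective (Prod.ext ha ha')) (interState_injective (Prod.ext hy hy')))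
  unfold size
  nlinarith

end Inter

/-! ### Determinization and complement -/

section Determinize

variable (A : VRA I C R)

/-- The states to which `w` leads from some state in `V`. -/
def reach (V : Set A.States) (w : List (PSym I C R)) : Set A.States :=
  {p | ∃ q ∈ V, A.Path q w p}

/-- The initial states of all automata whose procedural symbols are linked to `l`. -/
def linkedStart (l : C × R) : Set A.States :=
  {q | ∃ (J : A.Proc) (i : A.State (some J)), A.link J = l ∧ i ∈ (A.aut (some J)).start ∧
    q = ⟨some J, i⟩}

/-- The subset transition function. A procedural symbol of the determinized VRA is a link together
with a set `U` of states; on it, `V` takes all transitions on procedural symbols of `A` with that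
link and with a final state in `U`. -/
def subsetStep (V : Set A.States) : I ⊕ ((C × R) × Set A.States) → Set A.States
  | .inl a => {p | ∃ q ∈ V, (q, Sum.inl a, p) ∈ A.trans}
  | .inr (l, U) => {p | ∃ q ∈ V, ∃ J : A.Proc, A.link J = l ∧
      (∃ f ∈ (A.aut (some J)).accept, ⟨some J, f⟩ ∈ U) ∧ (q, Sum.inr J, p) ∈ A.trans}

/-- The determinization of a VRA. The automaton of the procedural symbol `(l, U)` accepts the
well-matched words that lead from the initial states of the automata linked to `l` exactly to the
set `U`. -/
def determinize [Finite C] [Finite R] : VRA I C R where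
  Proc := (C × R) × Set A.States
  finite_proc := inferInstance
  link P := P.1
  State _ := Set A.States
  finite_state _ := inferInstance
  aut
    | none =>
      { step := fun V a => {A.subsetStep V a}
        start := {{q | ∃ i ∈ (A.aut none).start, q = ⟨none, i⟩}}
        accept := {V | ∃ f ∈ (A.aut none).accept, ⟨none, f⟩ ∈ V} }
    | some P =>
      { step := fun V a => {A.subsetStep V a}
        start := {A.linkedStart P.1}
        accept := {P.2} }

variable {A}

theorem reach_nil (V : Set A.States) : A.reach V [] = V := by
  simp [reach, path_nil_iff]

theorem reach_int (V : Set A.States) (a : I) (w : List (PSym I C R)) :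
    A.reach V (PSym.int a :: w) = A.reach (A.subsetStep V (.inl a)) w := by
  ext s
  simp only [reach, subsetStep, path_int_iff, Set.mem_ofPred_eq]
  grind

/-- The set `U` reached from all initial states linked to `A.link J` tells whether `J` accepts:
paths stay within one automaton, so the states of `J` in `U` are reached from initial states of `J`. -/
theorem exists_accept_mem_reach_linkedStart {J : A.Proc} {u : List (PSym I C R)} :
    (∃ f ∈ (A.aut (some J)).accept, ⟨some J, f⟩ ∈ A.reach (A.linkedStart (A.link J)) u) ↔
      u ∈ A.langOf (some J) := by
  rw [mem_langOf]
  constructor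
  · rintro ⟨f, hf, _, ⟨J', i, hJ', hi, rfl⟩, h⟩
    obtain rfl : J' = J := Option.some.inj h.fst_eq
    exact ⟨i, hi, f, hf, h⟩
  · rintro ⟨i, hi, f, hf, h⟩
    exact ⟨f, hf, _, ⟨J, i, rfl, hi, rfl⟩, h⟩

theorem exists_accept_mem_reach_start {w : List (PSym I C R)} :
    (∃ f ∈ (A.aut none).accept,
      ⟨none, f⟩ ∈ A.reach {q | ∃ i ∈ (A.aut none).start, q = ⟨none, i⟩} w) ↔ w ∈ A.lang := by
  rw [lang, mem_langOf]
  constructor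
  · rintro ⟨f, hf, _, ⟨i, hi, rfl⟩, h⟩
    exact ⟨i, hi, f, hf, h⟩
  · rintro ⟨i, hi, f, hf, h⟩
    exact ⟨f, hf, _, ⟨i, hi, rfl⟩, h⟩

/-- One step of the subset construction on a nested word: for every `J` linked to `(c, r)`, the set
reached by `u` decides whether a transition on `J` can read `c u r`. -/
theorem reach_call (V : Set A.States) (c : C) (r : R) {u : List (PSym I C R)}
    (hu : WellMatched u) (w : List (PSym I C R)) :
    A.reach V (PSym.call c :: (u ++ PSym.ret r :: w)) =
      A.reach (A.subsetStep V (.inr ((c, r), A.reach (A.linkedStart (c, r)) u))) w := by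
  ext s
  constructor
  · rintro ⟨q, hq, h⟩
    obtain ⟨J, p, hJ, ht, hu', hw⟩ := (path_call_iff hu).1 h
    exact ⟨p, ⟨q, hq, J, hJ, hJ ▸ exists_accept_mem_reach_linkedStart.2 hu', ht⟩, hw⟩
  · rintro ⟨p, ⟨q, hq, J, hJ, hu', ht⟩, hw⟩
    exact ⟨q, hq, (path_call_iff hu).2
      ⟨J, p, hJ, ht, exists_accept_mem_reach_linkedStart.1 (by rwa [hJ]), hw⟩⟩

variable [Finite C] [Finite R]

/-- The set of states of `A` that underlies a state of the determinization. -/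
def stateSet (x : A.determinize.States) : Set A.States := x.2

theorem states_determinize_ext {x y : A.determinize.States} (h : x.1 = y.1)
    (h' : stateSet x = stateSet y) : x = y := by
  obtain ⟨J, V⟩ := x
  obtain ⟨K, W⟩ := y
  obtain rfl : J = K := h
  obtain rfl : V = W := h'
  rfl

theorem mem_determinize_step {J : Option A.determinize.Proc} {V W : Set A.States}
    {a : I ⊕ ((C × R) × Set A.States)} :
    W ∈ (A.determinize.aut J).step V a ↔ W = A.subsetStep V a := by
  cases J <;> exact Iff.rfl

theorem mem_determinize_trans {x y : A.determinize.States}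
    {a : I ⊕ ((C × R) × Set A.States)} :
    (x, a, y) ∈ A.determinize.trans ↔
      y.1 = x.1 ∧ stateSet y = A.subsetStep (stateSet x) a := by
  constructor
  · rintro ⟨J, V, a, W, h, e⟩
    cases e
    exact ⟨rfl, mem_determinize_step.1 h⟩
  · obtain ⟨J, V⟩ := x
    obtain ⟨K, W⟩ := y
    rintro ⟨rfl : K = J, h⟩
    exact mem_trans_self.2 (mem_determinize_step.2 h)

/-- Every automaton of the determinized VRA reads every well-matched word in exactly one way, and
computes the set of the states reached in the given VRA. -/
theorem path_determinize_iff {x y : A.determinize.States} {w : List (PSym I C R)} :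
    A.determinize.Path x w y ↔
      WellMatched w ∧ y.1 = x.1 ∧ stateSet y = A.reach (stateSet x) w := by
  constructor
  · intro h
    refine ⟨h.wellMatched, h.fst_eq.symm, ?_⟩
    induction h with
    | nil x => rw [reach_nil]
    | int h _ ih =>
      rw [ih, (mem_determinize_trans.1 h).2]
      exact (reach_int _ _ _).symm
    | @proc _ _ _ P _ _ _ _ h hi hf hu _ ih₁ ih₂ =>
      obtain ⟨⟨c, r⟩, U⟩ := P
      cases hi
      cases hf
      rw [ih₂, (mem_determinize_trans.1 h).2]
      obtain rfl : U = A.reach (A.linkedStart (c, r)) _ := ih₁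
      exact (reach_call _ c r hu.wellMatched _).symm
  · rintro ⟨hw, h₁, h₂⟩
    induction hw using WellMatched.leftInduction generalizing x y with
    | nil => exact path_nil_iff.2 (states_determinize_ext h₁.symm (by rw [h₂, reach_nil]))
    | int a w hw ih =>
      let z : A.determinize.States := ⟨x.1, A.subsetStep (stateSet x) (.inl a)⟩
      exact .int (p := z) (mem_determinize_trans.2 ⟨rfl, rfl⟩) (ih h₁ (by rw [h₂, reach_int]; rfl))
    | call c r u w hu hw ihu ihw =>
      let U := A.reach (A.linkedStart (c, r)) u
      let z : A.determinize.States := ⟨x.1, A.subsetStep (stateSet x) (.inr ((c, r), U))⟩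
      exact .proc (A := A.determinize) (J := ((c, r), U)) (p := z)
        (mem_determinize_trans.2 ⟨rfl, rfl⟩) (i := A.linkedStart (c, r)) rfl (f := U) rfl
        (ihu rfl rfl) (ihw h₁ (by rw [h₂, reach_call _ c r hu]; rfl))

theorem mem_langOf_determinize_some {l : C × R} {U : Set A.States} {w : List (PSym I C R)} :
    w ∈ A.determinize.langOf (some (l, U)) ↔ WellMatched w ∧ U = A.reach (A.linkedStart l) w := by
  rw [mem_langOf]
  constructor
  · rintro ⟨V, hV, W, hW, h⟩
    obtain ⟨hw, -, h⟩ := path_determinize_iff.1 h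
    cases hV
    cases hW
    exact ⟨hw, h⟩
  · rintro ⟨hw, h⟩
    exact ⟨_, rfl, _, rfl, path_determinize_iff.2 ⟨hw, rfl, h⟩⟩

theorem lang_determinize : A.determinize.lang = A.lang := by
  ext w
  refine Iff.trans ?_ exists_accept_mem_reach_start
  rw [lang, mem_langOf]
  constructor
  · rintro ⟨_, rfl, V, hV, h⟩
    obtain rfl := (path_determinize_iff.1 h).2.2
    exact hV
  · intro h
    refine ⟨_, rfl, _, h, path_determinize_iff.2 ⟨?_, rfl, rfl⟩⟩
    exact wellMatched_of_mem_langOf (exists_accept_mem_reach_start.1 h)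

theorem allDFA_determinize : A.determinize.AllDFA := by
  intro J
  refine ⟨by cases J <;> exact ⟨_, rfl⟩, fun V a W hW W' hW' => ?_⟩
  rw [mem_determinize_step.1 hW, mem_determinize_step.1 hW']

theorem codeterministic_determinize : A.determinize.Codeterministic := by
  rintro c r ⟨l, U⟩ ⟨l', U'⟩ (rfl : l = _) (rfl : l' = _) hne
  ext w
  rw [Language.mem_inf]
  refine iff_of_false ?_ id
  rintro ⟨h, h'⟩
  refine hne (Prod.ext rfl ?_)
  exact (mem_langOf_determinize_some.1 h).2.trans (mem_langOf_determinize_some.1 h').2.symm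

theorem complete_determinize : A.determinize.Complete := by
  refine ⟨fun x a => ⟨⟨x.1, A.subsetStep (stateSet x) a⟩, mem_determinize_trans.2 ⟨rfl, rfl⟩⟩,
    fun c r => ?_⟩
  ext w
  simp only [Language.mem_iSup]
  constructor
  · rintro ⟨P, -, h⟩
    exact wellMatched_of_mem_langOf h
  · intro hw
    exact ⟨((c, r), A.reach (A.linkedStart (c, r)) w), rfl,
      mem_langOf_determinize_some.2 ⟨hw, rfl⟩⟩

end Determinize

section FlipStart

variable {A : VRA I C R}

theorem trans_flipStart : A.flipStart.trans = A.trans := by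
  ext t
  constructor
  · rintro ⟨_ | J, q, a, p, hp, e⟩
    · exact ⟨none, q, a, p, hp, e⟩
    · exact ⟨some J, q, a, p, hp, e⟩
  · rintro ⟨_ | J, q, a, p, hp, e⟩
    · exact ⟨none, q, a, p, hp, e⟩
    · exact ⟨some J, q, a, p, hp, e⟩

theorem size_flipStart : A.flipStart.size = A.size := by
  unfold size
  rw [trans_flipStart]
  rfl

theorem Path.of_flipStart {q p : A.flipStart.States} {w : List (PSym I C R)}
    (h : A.flipStart.Path q w p) : A.Path q w p := by
  induction h with
  | nil => exact .nil _
  | int h _ ih => exact .int (trans_flipStart.subset h) ih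
  | proc h hi hf _ _ ih₁ ih₂ => exact .proc (trans_flipStart.subset h) hi hf ih₁ ih₂

theorem Path.flipStart {q p : A.States} {w : List (PSym I C R)}
    (h : A.Path q w p) : A.flipStart.Path q w p := by
  induction h with
  | nil => exact .nil _
  | int h _ ih => exact .int (A := A.flipStart) (trans_flipStart.superset h) ih
  | proc h hi hf _ _ ih₁ ih₂ =>
    exact .proc (A := A.flipStart) (trans_flipStart.superset h) hi hf ih₁ ih₂

theorem lang_flipStart_determinize [Finite C] [Finite R] :
    A.determinize.flipStart.lang = WM I C R \ A.lang := by
  ext w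
  change w ∈ A.determinize.flipStart.langOf none ↔ WellMatched w ∧ w ∉ A.lang
  rw [mem_langOf, ← exists_accept_mem_reach_start]
  constructor
  · rintro ⟨_, rfl, V, hV, h⟩
    obtain ⟨hw, -, rfl⟩ := path_determinize_iff.1 h.of_flipStart
    exact ⟨hw, hV⟩
  · rintro ⟨hw, h⟩
    exact ⟨_, rfl, _, h, Path.flipStart (q := ⟨none, _⟩) (p := ⟨none, _⟩)
      (path_determinize_iff.2 ⟨hw, rfl, rfl⟩)⟩

end FlipStart

/-- With `n` states in `A` there are `|C| |R| 2 ^ n` procedural symbols and `2 ^ n` states in each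
automaton, and the transitions are determined by their source and their label. -/
theorem size_determinize_le [Finite I] [Finite C] [Finite R] (A : VRA I C R) :
    A.determinize.size ≤
      2 ^ ((2 * Nat.card (C × R) + Nat.card I + 3) * max 1 A.size) := by
  set k := Nat.card (C × R)
  set m := Nat.card I
  set n := Nat.card A.States
  set N := 2 ^ n
  have hN : 1 ≤ N := Nat.one_le_two_pow
  have hset : Nat.card (Set A.States) = N := by
    rw [← Set.ncard_univ, ← Set.powerset_univ, Set.ncard_powerset, Set.ncard_univ]
  have hproc : Nat.card A.determinize.Proc = k * N := by
    rw [← hset]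
    exact Nat.card_prod _ _
  have hstates : Nat.card A.determinize.States = (k * N + 1) * N := by
    rw [← hproc, ← Finite.card_option, ← hset, ← Nat.card_prod]
    exact Nat.card_congr (Equiv.sigmaEquivProd _ _)
  have htrans : A.determinize.trans.ncard ≤ (k * N + 1) * N * (m + k * N) := by
    rw [← hstates, ← hproc, ← Nat.card_sum, ← Nat.card_prod, ← Set.ncard_univ]
    refine Set.ncard_le_ncard_of_injOn (fun t => (t.1, t.2.1)) (fun _ _ => Set.mem_univ _) ?_
    rintro ⟨x, a, y⟩ h ⟨x', a', y'⟩ h' e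
    obtain ⟨rfl, rfl⟩ := Prod.mk.inj e
    obtain ⟨h₁, h₂⟩ := mem_determinize_trans.1 h
    obtain ⟨h₁', h₂'⟩ := mem_determinize_trans.1 h'
    rw [states_determinize_ext (h₁.trans h₁'.symm) (h₂.trans h₂'.symm)]
  have hn : n ≤ max 1 A.size := (Nat.le_add_right _ _).trans (le_max_right 1 A.size)
  calc A.determinize.size
      ≤ (k * N + 1) * N + (k * N + 1) * N * (m + k * N) :=
        Nat.add_le_add hstates.le htrans
    _ = (k * N + 1) * N * (k * N + m + 1) := by ring
    _ ≤ (k * N + N) * N * (k * N + m * N + N) := by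
        gcongr
        exact Nat.le_mul_of_pos_right m hN
    _ = (k + 1) * (k + m + 1) * N ^ 3 := by ring
    _ ≤ 2 ^ k * 2 ^ (k + m) * N ^ 3 := by
        gcongr
        · exact Nat.lt_two_pow_self
        · exact Nat.lt_two_pow_self
    _ = 2 ^ (2 * k + m + 3 * n) := by
        rw [← pow_mul, ← pow_add, ← pow_add]
        congr 1
        ring
    _ ≤ 2 ^ ((2 * k + m + 3) * max 1 A.size) := by
        gcongr
        · norm_num
        · nlinarith [le_max_left 1 A.size]

end VRA

/-! ### Automata without ε-transitions -/

namespace NFA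

universe v w x

variable {α : Type v} {β : Type w} {σ : Type x}

/-- The set of transitions of an NFA. -/
def transSet (M : NFA α σ) : Set (σ × α × σ) := {t | t.2.2 ∈ M.step t.1 t.2.1}

theorem nil_mem_acceptsFrom_singleton {M : NFA α σ} {q : σ} :
    [] ∈ M.acceptsFrom {q} ↔ q ∈ M.accept := by
  simp [mem_acceptsFrom]

theorem cons_mem_acceptsFrom_singleton {M : NFA α σ} {q : σ} {a : α} {x : List α} :
    a :: x ∈ M.acceptsFrom {q} ↔ ∃ p ∈ M.step q a, x ∈ M.acceptsFrom {p} := by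
  simp only [mem_acceptsFrom, evalFrom_cons, stepSet_singleton]
  constructor
  · rintro ⟨s, hs, h⟩
    obtain ⟨p, hp, h⟩ := M.mem_evalFrom_iff_exists.1 h
    exact ⟨p, hp, s, hs, h⟩
  · rintro ⟨p, hp, s, hs, h⟩
    exact ⟨s, hs, M.mem_evalFrom_iff_exists.2 ⟨p, hp, h⟩⟩

theorem mem_accepts_iff_exists {M : NFA α σ} {x : List α} :
    x ∈ M.accepts ↔ ∃ q ∈ M.start, x ∈ M.acceptsFrom {q} := by
  change (∃ s ∈ M.accept, s ∈ M.evalFrom M.start x) ↔ _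
  simp only [mem_acceptsFrom]
  constructor
  · rintro ⟨s, hs, h⟩
    obtain ⟨q, hq, h⟩ := M.mem_evalFrom_iff_exists.1 h
    exact ⟨q, hq, s, hs, h⟩
  · rintro ⟨q, hq, s, hs, h⟩
    exact ⟨s, hs, M.mem_evalFrom_iff_exists.2 ⟨q, hq, h⟩⟩

theorem nil_mem_accepts {M : NFA α σ} : [] ∈ M.accepts ↔ ∃ q ∈ M.start, q ∈ M.accept := by
  simp only [mem_accepts_iff_exists, nil_mem_acceptsFrom_singleton]

theorem cons_mem_accepts {M : NFA α σ} {a : α} {x : List α} :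
    a :: x ∈ M.accepts ↔ ∃ q ∈ M.start, ∃ p ∈ M.step q a, x ∈ M.acceptsFrom {p} := by
  simp only [mem_accepts_iff_exists, cons_mem_acceptsFrom_singleton]

/-- The NFA in which every label is renamed by `f`. -/
def relabel (f : α → β) (M : NFA α σ) : NFA β σ where
  step q b := {p | ∃ a, f a = b ∧ p ∈ M.step q a}
  start := M.start
  accept := M.accept

theorem mem_acceptsFrom_relabel {f : α → β} {M : NFA α σ} {q : σ} {y : List β} :
    y ∈ (M.relabel f).acceptsFrom {q} ↔ ∃ x ∈ M.acceptsFrom {q}, x.map f = y := by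
  induction y generalizing q with
  | nil => simp [relabel]
  | cons b y ih =>
    simp only [cons_mem_acceptsFrom_singleton, ih]
    constructor
    · rintro ⟨p, ⟨a, rfl, hp⟩, x, hx, rfl⟩
      exact ⟨a :: x, cons_mem_acceptsFrom_singleton.2 ⟨p, hp, hx⟩, rfl⟩
    · rintro ⟨_ | ⟨a, x⟩, hx, e⟩
      · simp at e
      · obtain ⟨rfl, rfl⟩ := List.cons.inj e
        obtain ⟨p, hp, hx⟩ := cons_mem_acceptsFrom_singleton.1 hx
        exact ⟨p, ⟨a, rfl, hp⟩, x, hx, rfl⟩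

theorem accepts_relabel (f : α → β) (M : NFA α σ) :
    (M.relabel f).accepts = Language.map f M.accepts := by
  ext y
  change _ ↔ ∃ x ∈ M.accepts, x.map f = y
  simp only [mem_accepts_iff_exists, mem_acceptsFrom_relabel]
  constructor
  · rintro ⟨q, hq, x, hx, e⟩
    exact ⟨x, ⟨q, hq, hx⟩, e⟩
  · rintro ⟨x, ⟨q, hq, hx⟩, e⟩
    exact ⟨q, hq, x, hx, e⟩

theorem transSet_relabel (f : α → β) (M : NFA α σ) :
    (M.relabel f).transSet = Prod.map id (Prod.map f id) '' M.transSet := by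
  ext ⟨q, b, p⟩
  constructor
  · rintro ⟨a, rfl, h⟩
    exact ⟨(q, a, p), h, rfl⟩
  · rintro ⟨⟨q, a, p⟩, h, e⟩
    cases e
    exact ⟨a, rfl, h⟩

section Binary

variable {τ : Type x} (M : NFA α σ) (N : NFA α τ)

/-- The disjoint union of two NFAs. -/
def union : NFA α (σ ⊕ τ) where
  step
    | .inl q, a => Sum.inl '' M.step q a
    | .inr q, a => Sum.inr '' N.step q a
  start := Sum.inl '' M.start ∪ Sum.inr '' N.start
  accept := Sum.inl '' M.accept ∪ Sum.inr '' N.accept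

/-- The concatenation of two NFAs, with the state `.inr none` between them as a hub: every
transition into a final state of `M` is copied to the hub, and every transition that leaves an
initial state of `N` is copied from the hub. Its transitions are at most twice as many as those of
`M` and `N` together, whereas a direct connection would multiply numbers of transitions. -/
def concat : NFA α (σ ⊕ Option τ) where
  step
    | .inl q, a => Sum.inl '' M.step q a ∪
        {s | s = .inr none ∧ ∃ p ∈ M.step q a, p ∈ M.accept}
    | .inr none, a => (fun p => .inr (some p)) '' {p | ∃ i ∈ N.start, p ∈ N.step i a}
    | .inr (some q), a => (fun p => .inr (some p)) '' N.step q a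
  start := Sum.inl '' M.start ∪ {s | s = .inr none ∧ [] ∈ M.accepts}
  accept := (fun p => .inr (some p)) '' N.accept ∪ {s | s = .inr none ∧ [] ∈ N.accepts}

/-- The Kleene star of an NFA, with a single initial and final state `none`, to which every
transition into a final state of `M` is copied, and from which every transition that leaves an
initial state of `M` is copied. -/
def star : NFA α (Option σ) where
  step
    | none, a => some '' {p | ∃ i ∈ M.start, p ∈ M.step i a} ∪
        {s | s = none ∧ ∃ i ∈ M.start, ∃ p ∈ M.step i a, p ∈ M.accept}
    | some q, a => some '' M.step q a ∪ {s | s = none ∧ ∃ p ∈ M.step q a, p ∈ M.accept}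
  start := {none}
  accept := {none}

variable {M N}

theorem acceptsFrom_union_inl {q : σ} :
    (M.union N).acceptsFrom {.inl q} = M.acceptsFrom {q} := by
  ext x
  induction x generalizing q with
  | nil => simp [union]
  | cons a x ih =>
    simp only [cons_mem_acceptsFrom_singleton]
    simp [union, ← ih]

theorem acceptsFrom_union_inr {q : τ} :
    (M.union N).acceptsFrom {.inr q} = N.acceptsFrom {q} := by
  ext x
  induction x generalizing q with
  | nil => simp [union]
  | cons a x ih =>
    simp only [cons_mem_acceptsFrom_singleton]
    simp [union, ← ih]

theorem accepts_union : (M.union N).accepts = M.accepts + N.accepts := by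
  ext x
  rw [Language.mem_add]
  simp only [mem_accepts_iff_exists, ← acceptsFrom_union_inl (M := M) (N := N),
    ← acceptsFrom_union_inr (M := M) (N := N)]
  simp [union, or_and_right, exists_or]

theorem acceptsFrom_concat_inr_some {q : τ} :
    (M.concat N).acceptsFrom {.inr (some q)} = N.acceptsFrom {q} := by
  ext x
  induction x generalizing q with
  | nil => simp [concat]
  | cons a x ih =>
    simp only [cons_mem_acceptsFrom_singleton]
    simp [concat, ← ih]

theorem acceptsFrom_concat_hub :
    (M.concat N).acceptsFrom {.inr none} = N.accepts := by
  ext x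
  cases x with
  | nil => simp [concat]
  | cons a x =>
    rw [cons_mem_acceptsFrom_singleton, cons_mem_accepts]
    constructor
    · rintro ⟨_, ⟨p, ⟨i, hi, hp⟩, rfl⟩, h⟩
      exact ⟨i, hi, p, hp, by rwa [acceptsFrom_concat_inr_some] at h⟩
    · rintro ⟨i, hi, p, hp, h⟩
      exact ⟨_, ⟨p, ⟨i, hi, hp⟩, rfl⟩, by rwa [acceptsFrom_concat_inr_some]⟩

theorem mem_acceptsFrom_concat_inl {q : σ} {x : List α} :
    x ∈ (M.concat N).acceptsFrom {.inl q} ↔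
      ∃ u ∈ M.acceptsFrom {q}, u ≠ [] ∧ ∃ v ∈ N.accepts, u ++ v = x := by
  induction x generalizing q with
  | nil =>
    simp [concat]
  | cons a x ih =>
    rw [cons_mem_acceptsFrom_singleton]
    constructor
    · rintro ⟨_, ⟨p, hp, rfl⟩ | ⟨rfl, p, hp, hf⟩, h⟩
      · obtain ⟨u, hu, -, v, hv, rfl⟩ := ih.1 h
        exact ⟨a :: u, cons_mem_acceptsFrom_singleton.2 ⟨p, hp, hu⟩, by simp, v, hv, rfl⟩
      · rw [acceptsFrom_concat_hub] at h
        exact ⟨[a], cons_mem_acceptsFrom_singleton.2 ⟨p, hp, nil_mem_acceptsFrom_singleton.2 hf⟩,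
          by simp, x, h, rfl⟩
    · rintro ⟨_ | ⟨b, u⟩, hu, hne, v, hv, e⟩
      · exact absurd rfl hne
      obtain ⟨rfl, rfl⟩ := List.cons.inj e
      obtain ⟨p, hp, hu⟩ := cons_mem_acceptsFrom_singleton.1 hu
      cases u with
      | nil =>
        exact ⟨_, .inr ⟨rfl, p, hp, nil_mem_acceptsFrom_singleton.1 hu⟩,
          by rwa [acceptsFrom_concat_hub]⟩
      | cons b u => exact ⟨_, .inl ⟨p, hp, rfl⟩, ih.2 ⟨_, hu, by simp, v, hv, rfl⟩⟩

theorem accepts_concat : (M.concat N).accepts = M.accepts * N.accepts := by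
  ext x
  rw [Language.mem_mul, mem_accepts_iff_exists]
  constructor
  · rintro ⟨_, ⟨q, hq, rfl⟩ | ⟨rfl, h⟩, hx⟩
    · obtain ⟨u, hu, -, v, hv, rfl⟩ := mem_acceptsFrom_concat_inl.1 hx
      exact ⟨u, mem_accepts_iff_exists.2 ⟨q, hq, hu⟩, v, hv, rfl⟩
    · exact ⟨[], h, x, by rwa [acceptsFrom_concat_hub] at hx, rfl⟩
  · rintro ⟨u, hu, v, hv, rfl⟩
    cases u with
    | nil => exact ⟨_, .inr ⟨rfl, hu⟩, by rwa [acceptsFrom_concat_hub]⟩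
    | cons a u =>
      obtain ⟨q, hq, hu⟩ := mem_accepts_iff_exists.1 hu
      exact ⟨_, .inl ⟨q, hq, rfl⟩, mem_acceptsFrom_concat_inl.2 ⟨_, hu, by simp, v, hv, rfl⟩⟩

theorem mem_acceptsFrom_star_some {q : σ} {x : List α} :
    x ∈ M.star.acceptsFrom {some q} ↔
      ∃ u ∈ M.acceptsFrom {q}, u ≠ [] ∧ ∃ v ∈ M.star.accepts, u ++ v = x := by
  have hhub : M.star.accepts = M.star.acceptsFrom {none} := rfl
  induction x generalizing q with
  | nil =>
    simp [star]
  | cons a x ih =>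
    rw [cons_mem_acceptsFrom_singleton]
    constructor
    · rintro ⟨_, ⟨p, hp, rfl⟩ | ⟨rfl, p, hp, hf⟩, h⟩
      · obtain ⟨u, hu, -, v, hv, rfl⟩ := ih.1 h
        exact ⟨a :: u, cons_mem_acceptsFrom_singleton.2 ⟨p, hp, hu⟩, by simp, v, hv, rfl⟩
      · exact ⟨[a], cons_mem_acceptsFrom_singleton.2 ⟨p, hp, nil_mem_acceptsFrom_singleton.2 hf⟩,
          by simp, x, h, rfl⟩
    · rintro ⟨_ | ⟨b, u⟩, hu, hne, v, hv, e⟩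
      · exact absurd rfl hne
      obtain ⟨rfl, rfl⟩ := List.cons.inj e
      obtain ⟨p, hp, hu⟩ := cons_mem_acceptsFrom_singleton.1 hu
      cases u with
      | nil => exact ⟨_, .inr ⟨rfl, p, hp, nil_mem_acceptsFrom_singleton.1 hu⟩, hv⟩
      | cons b u => exact ⟨_, .inl ⟨p, hp, rfl⟩, ih.2 ⟨_, hu, by simp, v, hv, rfl⟩⟩

theorem cons_mem_accepts_star {a : α} {x : List α} :
    a :: x ∈ M.star.accepts ↔ ∃ i ∈ M.start, a :: x ∈ M.star.acceptsFrom {some i} := by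
  simp only [cons_mem_accepts, cons_mem_acceptsFrom_singleton]
  constructor
  · rintro ⟨_, rfl, _, ⟨p, ⟨i, hi, hp⟩, rfl⟩ | ⟨rfl, i, hi, hp⟩, h⟩
    · exact ⟨i, hi, _, .inl ⟨p, hp, rfl⟩, h⟩
    · exact ⟨i, hi, _, .inr ⟨rfl, hp⟩, h⟩
  · rintro ⟨i, hi, _, ⟨p, hp, rfl⟩ | ⟨rfl, hp⟩, h⟩
    · exact ⟨none, rfl, _, .inl ⟨p, ⟨i, hi, hp⟩, rfl⟩, h⟩
    · exact ⟨none, rfl, _, .inr ⟨rfl, i, hi, hp⟩, h⟩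

theorem accepts_star : M.star.accepts = M.accepts∗ := by
  ext x
  rw [Language.mem_kstar_iff_exists_nonempty]
  constructor
  · intro h
    induction hn : x.length using Nat.strong_induction_on generalizing x with
    | _ n ih =>
    cases x with
    | nil => exact ⟨[], rfl, by simp⟩
    | cons a x =>
      obtain ⟨i, hi, h⟩ := cons_mem_accepts_star.1 h
      obtain ⟨u, hu, hne, v, hv, e⟩ := mem_acceptsFrom_star_some.1 h
      have hlt : v.length < n := by
        rw [← hn, ← e, List.length_append]
        exact Nat.lt_add_of_pos_left (List.length_pos_iff.2 hne)
      obtain ⟨S, rfl, hS⟩ := ih _ hlt v hv rfl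
      refine ⟨u :: S, e.symm, ?_⟩
      rintro y (_ | ⟨_, hy⟩)
      · exact ⟨mem_accepts_iff_exists.2 ⟨i, hi, hu⟩, hne⟩
      · exact hS y hy
  · rintro ⟨S, rfl, hS⟩
    induction S with
    | nil => exact nil_mem_accepts.2 ⟨none, rfl, rfl⟩
    | cons u S ih =>
      obtain ⟨hu, hne⟩ := hS u (by simp)
      obtain ⟨i, hi, hu⟩ := mem_accepts_iff_exists.1 hu
      have := mem_acceptsFrom_star_some.2
        ⟨u, hu, hne, S.flatten, ih fun y hy => hS y (by simp [hy]), rfl⟩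
      obtain ⟨a, u, rfl⟩ := List.exists_cons_of_ne_nil hne
      exact cons_mem_accepts_star.2 ⟨i, hi, this⟩

theorem ncard_transSet_union_le [Finite α] [Finite σ] [Finite τ] :
    (M.union N).transSet.ncard ≤ M.transSet.ncard + N.transSet.ncard := by
  have h : (M.union N).transSet ⊆ (fun t => (.inl t.1, t.2.1, .inl t.2.2)) '' M.transSet ∪
      (fun t => (.inr t.1, t.2.1, .inr t.2.2)) '' N.transSet := by
    rintro ⟨q | q, a, p⟩ ⟨p, hp, rfl⟩
    · exact .inl ⟨(q, a, p), hp, rfl⟩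
    · exact .inr ⟨(q, a, p), hp, rfl⟩
  calc _ ≤ _ := Set.ncard_le_ncard h (Set.toFinite _)
    _ ≤ _ := Set.ncard_union_le _ _
    _ ≤ _ := add_le_add (Set.ncard_image_le (Set.toFinite _)) (Set.ncard_image_le (Set.toFinite _))

theorem ncard_transSet_concat_le [Finite α] [Finite σ] [Finite τ] :
    (M.concat N).transSet.ncard ≤ 2 * M.transSet.ncard + 2 * N.transSet.ncard := by
  have h : (M.concat N).transSet ⊆
      ((fun t => (.inl t.1, t.2.1, .inl t.2.2)) '' M.transSet ∪
        (fun t => (.inl t.1, t.2.1, .inr none)) '' M.transSet) ∪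
      ((fun t => (.inr none, t.2.1, .inr (some t.2.2))) '' N.transSet ∪
        (fun t => (.inr (some t.1), t.2.1, .inr (some t.2.2))) '' N.transSet) := by
    rintro ⟨q | _ | q, a, p⟩ hp
    · obtain ⟨p, hp, rfl⟩ | ⟨rfl, p, hp, -⟩ := hp
      · exact .inl (.inl ⟨(q, a, p), hp, rfl⟩)
      · exact .inl (.inr ⟨(q, a, p), hp, rfl⟩)
    · obtain ⟨p, ⟨i, -, hp⟩, rfl⟩ := hp
      exact .inr (.inl ⟨(i, a, p), hp, rfl⟩)
    · obtain ⟨p, hp, rfl⟩ := hp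
      exact .inr (.inr ⟨(q, a, p), hp, rfl⟩)
  calc _ ≤ _ := Set.ncard_le_ncard h (Set.toFinite _)
    _ ≤ _ := Set.ncard_union_le _ _
    _ ≤ _ := add_le_add (Set.ncard_union_le _ _) (Set.ncard_union_le _ _)
    _ ≤ (M.transSet.ncard + M.transSet.ncard) + (N.transSet.ncard + N.transSet.ncard) := by
        gcongr <;> exact Set.ncard_image_le (Set.toFinite _)
    _ = _ := by ring

theorem ncard_transSet_star_le [Finite α] [Finite σ] :
    M.star.transSet.ncard ≤ 4 * M.transSet.ncard := by
  have h : M.star.transSet ⊆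
      ((fun t => (some t.1, t.2.1, some t.2.2)) '' M.transSet ∪
        (fun t => (some t.1, t.2.1, none)) '' M.transSet) ∪
      ((fun t => (none, t.2.1, some t.2.2)) '' M.transSet ∪
        (fun t => (none, t.2.1, none)) '' M.transSet) := by
    rintro ⟨_ | q, a, p⟩ hp
    · obtain ⟨p, ⟨i, -, hp⟩, rfl⟩ | ⟨rfl, i, -, p, hp, -⟩ := hp
      · exact .inr (.inl ⟨(i, a, p), hp, rfl⟩)
      · exact .inr (.inr ⟨(i, a, p), hp, rfl⟩)
    · obtain ⟨p, hp, rfl⟩ | ⟨rfl, p, hp, -⟩ := hp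
      · exact .inl (.inl ⟨(q, a, p), hp, rfl⟩)
      · exact .inl (.inr ⟨(q, a, p), hp, rfl⟩)
  calc _ ≤ _ := Set.ncard_le_ncard h (Set.toFinite _)
    _ ≤ _ := Set.ncard_union_le _ _
    _ ≤ _ := add_le_add (Set.ncard_union_le _ _) (Set.ncard_union_le _ _)
    _ ≤ (M.transSet.ncard + M.transSet.ncard) + (M.transSet.ncard + M.transSet.ncard) := by
        gcongr <;> exact Set.ncard_image_le (Set.toFinite _)
    _ = _ := by ring

end Binary

end NFA

/-! ### Substitution into the starting automaton -/

namespace VRA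

variable {I C R : Type u}

section Subst

variable (A : VRA I C R)

/-- The words that can be read along a transition with a given label: an internal symbol stands for
itself, and a procedural symbol for the words of its language, enclosed in its call and its
return. -/
def letterLang : I ⊕ A.Proc → Language (PSym I C R)
  | .inl a => {[PSym.int a]}
  | .inr J => {[PSym.call (A.link J).1]} * A.langOf (some J) * {[PSym.ret (A.link J).2]}

/-- The language obtained from `L` by substituting `A.letterLang` for the letters. -/
def substLang (L : Language (I ⊕ A.Proc)) : Language (PSym I C R) :=
  {w | ∃ x ∈ L, w ∈ (x.map A.letterLang).prod}

variable {A}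

theorem mem_substLang {L : Language (I ⊕ A.Proc)} {w : List (PSym I C R)} :
    w ∈ A.substLang L ↔ ∃ x ∈ L, w ∈ (x.map A.letterLang).prod := Iff.rfl

theorem mem_letterLang_inl {a : I} {w : List (PSym I C R)} :
    w ∈ A.letterLang (.inl a) ↔ w = [PSym.int a] := Iff.rfl

theorem mem_letterLang_inr {J : A.Proc} {w : List (PSym I C R)} :
    w ∈ A.letterLang (.inr J) ↔
      ∃ u ∈ A.langOf (some J), w = PSym.call (A.link J).1 :: (u ++ [PSym.ret (A.link J).2]) := by
  constructor
  · rintro ⟨_, ⟨_, rfl, u, hu, rfl⟩, _, rfl, rfl⟩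
    exact ⟨u, hu, rfl⟩
  · rintro ⟨u, hu, rfl⟩
    exact ⟨_, ⟨_, rfl, u, hu, rfl⟩, _, rfl, rfl⟩

theorem Path.letter {q p s : A.States} {a : I ⊕ A.Proc} {u v : List (PSym I C R)}
    (h : (q, a, p) ∈ A.trans) (hu : u ∈ A.letterLang a) (hv : A.Path p v s) :
    A.Path q (u ++ v) s := by
  cases a with
  | inl a =>
    obtain rfl := mem_letterLang_inl.1 hu
    exact .int h hv
  | inr J =>
    obtain ⟨u, hu', rfl⟩ := mem_letterLang_inr.1 hu
    obtain ⟨i, hi, f, hf, hu'⟩ := mem_langOf.1 hu'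
    simpa using Path.proc h hi hf hu' hv

/-- A path reads a word that is obtained by substitution from the labels of its transitions. -/
theorem Path.exists_mem_evalFrom {q p : A.States} {w : List (PSym I C R)} (h : A.Path q w p)
    {J : Option A.Proc} {s t : A.State J} (hq : q = ⟨J, s⟩) (hp : p = ⟨J, t⟩) :
    ∃ x, t ∈ (A.aut J).evalFrom {s} x ∧ w ∈ (x.map A.letterLang).prod := by
  have step {q p : A.States} {a : I ⊕ A.Proc} {u v : List (PSym I C R)}
      {s t : A.State J} (hq : q = ⟨J, s⟩) (h : (q, a, p) ∈ A.trans) (hu : u ∈ A.letterLang a)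
      (ih : ∀ {s}, p = ⟨J, s⟩ →
        ∃ x, t ∈ (A.aut J).evalFrom {s} x ∧ v ∈ (x.map A.letterLang).prod) :
      ∃ x, t ∈ (A.aut J).evalFrom {s} x ∧ u ++ v ∈ (x.map A.letterLang).prod := by
    subst hq
    obtain ⟨K, p⟩ := p
    obtain rfl : J = K := fst_eq_of_mem_trans h
    obtain ⟨x, hx, hv⟩ := ih rfl
    refine ⟨a :: x, ?_, ?_⟩
    · rw [NFA.evalFrom_cons, NFA.stepSet_singleton, NFA.mem_evalFrom_iff_exists]
      exact ⟨p, mem_trans_self.1 h, hx⟩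
    · rw [List.map_cons, List.prod_cons]
      exact Language.append_mem_mul hu hv
  induction h generalizing s with
  | nil =>
    subst hq
    cases hp
    exact ⟨[], rfl, rfl⟩
  | int h _ ih => exact step hq h (mem_letterLang_inl.2 rfl) fun e => ih e hp
  | @proc _ _ _ J' _ _ _ _ h hi hf hu _ _ ih =>
    simpa using step hq h (mem_letterLang_inr.2 ⟨_, mem_langOf.2 ⟨_, hi, _, hf, hu⟩, rfl⟩)
      fun e => ih e hp

theorem path_of_mem_evalFrom {J : Option A.Proc} {x : List (I ⊕ A.Proc)} {s t : A.State J}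
    {w : List (PSym I C R)} (ht : t ∈ (A.aut J).evalFrom {s} x)
    (hw : w ∈ (x.map A.letterLang).prod) : A.Path ⟨J, s⟩ w ⟨J, t⟩ := by
  induction x generalizing s w with
  | nil =>
    obtain rfl : t = s := ht
    obtain rfl : w = [] := hw
    exact .nil _
  | cons a x ih =>
    rw [NFA.evalFrom_cons, NFA.stepSet_singleton, NFA.mem_evalFrom_iff_exists] at ht
    obtain ⟨p, hp, ht⟩ := ht
    rw [List.map_cons, List.prod_cons] at hw
    obtain ⟨u, hu, v, hv, rfl⟩ := Language.mem_mul.1 hw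
    exact .letter (mem_trans_self.2 hp) hu (ih ht hv)

/-- The recursive language of an automaton is its regular language over internal and procedural
symbols, with the languages of the procedural symbols substituted. -/
theorem langOf_eq_substLang (J : Option A.Proc) :
    A.langOf J = A.substLang (A.aut J).accepts := by
  ext w
  rw [mem_langOf]
  constructor
  · rintro ⟨i, hi, f, hf, h⟩
    obtain ⟨x, hx, hw⟩ := h.exists_mem_evalFrom rfl rfl
    exact ⟨x, ⟨f, hf, NFA.mem_evalFrom_iff_exists.2 ⟨i, hi, hx⟩⟩, hw⟩
  · rintro ⟨x, ⟨f, hf, hx⟩, hw⟩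
    obtain ⟨i, hi, hx⟩ := NFA.mem_evalFrom_iff_exists.1 hx
    exact ⟨i, hi, f, hf, path_of_mem_evalFrom hx hw⟩

theorem substLang_one : A.substLang 1 = 1 := by
  ext w
  constructor
  · rintro ⟨_, rfl, hw⟩
    exact hw
  · intro hw
    exact ⟨[], rfl, hw⟩

theorem substLang_add (L L' : Language (I ⊕ A.Proc)) :
    A.substLang (L + L') = A.substLang L + A.substLang L' := by
  ext w
  simp only [mem_substLang, Language.mem_add, or_and_right, exists_or]

theorem substLang_mul (L L' : Language (I ⊕ A.Proc)) :
    A.substLang (L * L') = A.substLang L * A.substLang L' := by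
  ext w
  simp only [mem_substLang, Language.mem_mul]
  constructor
  · rintro ⟨_, ⟨x, hx, y, hy, rfl⟩, hw⟩
    rw [List.map_append, List.prod_append] at hw
    obtain ⟨u, hu, v, hv, rfl⟩ := Language.mem_mul.1 hw
    exact ⟨u, ⟨x, hx, hu⟩, v, ⟨y, hy, hv⟩, rfl⟩
  · rintro ⟨u, ⟨x, hx, hu⟩, v, ⟨y, hy, hv⟩, rfl⟩
    refine ⟨_, ⟨x, hx, y, hy, rfl⟩, ?_⟩
    rw [List.map_append, List.prod_append]
    exact Language.append_mem_mul hu hv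

theorem substLang_pow (L : Language (I ⊕ A.Proc)) (n : ℕ) :
    A.substLang (L ^ n) = A.substLang L ^ n := by
  induction n with
  | zero => simpa using substLang_one
  | succ n ih => rw [pow_succ, pow_succ, substLang_mul, ih]

theorem substLang_kstar (L : Language (I ⊕ A.Proc)) :
    A.substLang L∗ = (A.substLang L)∗ := by
  ext w
  rw [Language.kstar_eq_iSup_pow, Language.kstar_eq_iSup_pow, Language.mem_iSup]
  simp only [← substLang_pow, mem_substLang, Language.mem_iSup]
  constructor
  · rintro ⟨x, ⟨n, hx⟩, hw⟩
    exact ⟨n, x, hx, hw⟩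
  · rintro ⟨n, x, hx, hw⟩
    exact ⟨x, ⟨n, hx⟩, hw⟩

end Subst

/-! ### A new starting automaton over a family of VRAs -/

section WithStart

variable {ι : Type} {σ : Type u} (A : ι → VRA I C R)

/-- The embedding of the labels of a member of a family into the labels of the family. -/
def familyLabel (k : ι) : I ⊕ (A k).Proc → I ⊕ (Σ k, (A k).Proc) := Sum.map id fun J => ⟨k, J⟩

/-- The starting automaton of a member of a family, over the labels of the family. -/
def familyStart (k : ι) : NFA (I ⊕ (Σ k, (A k).Proc)) ((A k).State none) :=
  ((A k).aut none).relabel (familyLabel A k)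

theorem card_familyStart_add_ncard_le [Finite I] (k : ι) :
    Nat.card ((A k).State none) + (familyStart A k).transSet.ncard ≤ (A k).size := by
  refine add_le_add (Nat.card_le_card_of_injective (Sigma.mk none) sigma_mk_injective) ?_
  rw [familyStart, NFA.transSet_relabel]
  refine (Set.ncard_image_le (Set.toFinite _)).trans ?_
  refine Set.ncard_le_ncard_of_injOn (fun t => (⟨none, t.1⟩, t.2.1, ⟨none, t.2.2⟩))
    (fun t ht => mem_trans_self.2 ht) ?_ (Set.toFinite _)
  rintro ⟨q, a, p⟩ - ⟨q', a', p'⟩ - h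
  simpa using h

variable [Finite ι] [Finite σ]

/-- The VRA with the procedural automata of all members of a family, and with a new starting
automaton `M`, which may use the procedural symbols of all of them. -/
def withStart (M : NFA (I ⊕ (Σ k, (A k).Proc)) σ) : VRA I C R where
  Proc := Σ k, (A k).Proc
  finite_proc := inferInstance
  link J := (A J.1).link J.2
  State
    | none => σ
    | some J => (A J.1).State (some J.2)
  finite_state
    | none => inferInstance
    | some _ => inferInstance
  aut
    | none => M
    | some J => ((A J.1).aut (some J.2)).relabel (familyLabel A J.1)

variable {A} {M : NFA (I ⊕ (Σ k, (A k).Proc)) σ}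

theorem Path.to_withStart {k : ι} {x y : (A k).States} {w : List (PSym I C R)}
    (h : (A k).Path x w y) {J : (A k).Proc} {q : (A k).State (some J)} (hx : x = ⟨some J, q⟩) :
    ∃ p, y = ⟨some J, p⟩ ∧ (withStart A M).Path ⟨some ⟨k, J⟩, q⟩ w ⟨some ⟨k, J⟩, p⟩ := by
  induction h generalizing J with
  | nil => exact ⟨q, hx, .nil _⟩
  | @int _ p _ a _ h _ ih =>
    subst hx
    obtain ⟨J', p⟩ := p
    obtain ⟨rfl, hp⟩ := mem_trans_iff.1 h
    obtain ⟨s, rfl, hs⟩ := ih rfl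
    exact ⟨s, rfl, .int (mem_trans_self.2 ⟨.inl a, rfl, hp⟩) hs⟩
  | @proc _ p _ K i f u v h hi hf _ _ ih₁ ih₂ =>
    subst hx
    obtain ⟨J', p⟩ := p
    obtain ⟨rfl, hp⟩ := mem_trans_iff.1 h
    obtain ⟨s, rfl, hs⟩ := ih₂ rfl
    obtain ⟨g, hg, hu⟩ := ih₁ rfl
    cases hg
    exact ⟨s, rfl, Path.proc (A := withStart A M) (J := ⟨k, K⟩) (i := i) (f := f)
      (mem_trans_self.2 ⟨.inr K, rfl, hp⟩) hi hf hu hs⟩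

theorem Path.of_withStart {x y : (withStart A M).States} {w : List (PSym I C R)}
    (h : (withStart A M).Path x w y) {k : ι} {J : (A k).Proc} {q : (A k).State (some J)}
    (hx : x = ⟨some ⟨k, J⟩, q⟩) :
    ∃ p : (A k).State (some J), y = ⟨some ⟨k, J⟩, p⟩ ∧
      (A k).Path ⟨some J, q⟩ w ⟨some J, p⟩ := by
  induction h generalizing k J with
  | nil => exact ⟨q, hx, .nil _⟩
  | @int _ p _ a _ h _ ih =>
    subst hx
    obtain ⟨J', p⟩ := p
    obtain ⟨rfl, b, hb, hp⟩ := mem_trans_iff.1 h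
    obtain ⟨s, rfl, hs⟩ := ih rfl
    cases b with
    | inr => cases hb
    | inl b =>
      cases hb
      exact ⟨s, rfl, .int (mem_trans_self.2 hp) hs⟩
  | @proc _ p _ K i f u v h hi hf _ _ ih₁ ih₂ =>
    subst hx
    obtain ⟨J', p⟩ := p
    obtain ⟨rfl, b, hb, hp⟩ := mem_trans_iff.1 h
    obtain ⟨s, rfl, hs⟩ := ih₂ rfl
    cases b with
    | inl => cases hb
    | inr b =>
      cases hb
      obtain ⟨g, hg, hu⟩ := ih₁ rfl
      cases hg
      exact ⟨s, rfl, .proc (mem_trans_self.2 hp) hi hf hu hs⟩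

theorem langOf_withStart_some (k : ι) (J : (A k).Proc) :
    (withStart A M).langOf (some ⟨k, J⟩) = (A k).langOf (some J) := by
  ext w
  rw [mem_langOf, mem_langOf]
  constructor
  · rintro ⟨i, hi, f, hf, h⟩
    obtain ⟨f', e, h⟩ := h.of_withStart rfl
    cases e
    exact ⟨i, hi, f, hf, h⟩
  · rintro ⟨i, hi, f, hf, h⟩
    obtain ⟨f', e, h⟩ := h.to_withStart (M := M) rfl
    cases e
    exact ⟨i, hi, f, hf, h⟩

theorem letterLang_withStart (k : ι) (a : I ⊕ (A k).Proc) :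
    (withStart A M).letterLang (familyLabel A k a) = (A k).letterLang a := by
  cases a with
  | inl a => rfl
  | inr J =>
    change _ * (withStart A M).langOf (some ⟨k, J⟩) * _ = _
    rw [langOf_withStart_some]
    rfl

theorem lang_withStart : (withStart A M).lang = (withStart A M).substLang M.accepts :=
  langOf_eq_substLang none

theorem substLang_accepts_familyStart (k : ι) :
    (withStart A M).substLang (familyStart A k).accepts = (A k).lang := by
  rw [familyStart, NFA.accepts_relabel]
  refine Eq.trans ?_ (langOf_eq_substLang none).symm
  have hmap (x : List (I ⊕ (A k).Proc)) :
      (x.map (familyLabel A k)).map (withStart A M).letterLang = x.map (A k).letterLang := by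
    exact List.map_map.trans (List.map_congr_left fun a _ => letterLang_withStart k a)
  ext w
  constructor
  · rintro ⟨_, ⟨x, hx, rfl⟩, hw⟩
    exact ⟨x, hx, hmap x ▸ hw⟩
  · rintro ⟨x, hx, hw⟩
    exact ⟨_, ⟨x, hx, rfl⟩, (hmap x).symm ▸ hw⟩

/-- A state of `VRA.withStart`, as a state of the new starting automaton or of a member of the
family. -/
def withStartState : (withStart A M).States → σ ⊕ (Σ k, (A k).States)
  | ⟨none, q⟩ => .inl q
  | ⟨some ⟨k, J⟩, q⟩ => .inr ⟨k, some J, q⟩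

theorem withStartState_injective :
    Function.Injective (withStartState : (withStart A M).States → _) := by
  rintro ⟨_ | ⟨k, J⟩, q⟩ ⟨_ | ⟨k', J'⟩, q'⟩ h
  · cases h
    rfl
  · cases h
  · cases h
  · cases h
    rfl

theorem size_withStart_le [Finite I] [Fintype ι] :
    (withStart A M).size ≤ Nat.card σ + M.transSet.ncard + ∑ k, (A k).size := by
  have hs : Nat.card (withStart A M).States ≤ Nat.card σ + ∑ k, Nat.card (A k).States := by
    rw [← Nat.card_sigma, ← Nat.card_sum]
    exact Nat.card_le_card_of_injective _ withStartState_injective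
  have ht : (withStart A M).trans.ncard ≤ M.transSet.ncard + ∑ k, (A k).trans.ncard := by
    have hinj : Function.Injective
        (Prod.map withStartState (Prod.map id withStartState) :
          (withStart A M).States × (I ⊕ (withStart A M).Proc) × (withStart A M).States → _) :=
      withStartState_injective.prodMap (Function.injective_id.prodMap withStartState_injective)
    rw [← Set.ncard_image_of_injective _ hinj]
    have hsub : Prod.map withStartState (Prod.map id withStartState) '' (withStart A M).trans ⊆
        (fun t => (.inl t.1, t.2.1, .inl t.2.2)) '' M.transSet ∪
        ⋃ k, (fun t => (.inr ⟨k, t.1⟩, familyLabel A k t.2.1, .inr ⟨k, t.2.2⟩)) ''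
          (A k).trans := by
      rintro _ ⟨_, ⟨_ | ⟨k, J⟩, q, a, p, h, rfl⟩, rfl⟩
      · exact .inl ⟨(q, a, p), h, rfl⟩
      · obtain ⟨b, rfl, h⟩ := h
        exact .inr (Set.mem_iUnion.2 ⟨k, (⟨some J, q⟩, b, ⟨some J, p⟩), mem_trans_self.2 h, rfl⟩)
    calc _ ≤ _ := Set.ncard_le_ncard hsub (Set.toFinite _)
      _ ≤ _ := Set.ncard_union_le _ _
      _ ≤ _ := add_le_add (Set.ncard_image_le (Set.toFinite _)) (Set.ncard_iUnion_le_of_fintype _)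
      _ ≤ _ := by
        gcongr
        exact Set.ncard_image_le (Set.toFinite _)
  unfold size
  rw [Finset.sum_add_distrib]
  omega

end WithStart

end VRA

/-! ### Closure properties -/

namespace VRA

variable {I C R : Type u}

theorem lang_eq_zero_of_size_eq_zero {A : VRA I C R} (h : A.size = 0) : A.lang = 0 := by
  have : IsEmpty A.States :=
    (Finite.card_eq_zero_iff (α := A.States)).1 (Nat.add_eq_zero_iff.1 h).1
  ext w
  refine iff_of_false ?_ (Language.notMem_zero w)
  rintro ⟨i, -⟩
  exact this.false ⟨none, i⟩

variable [Finite I]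

theorem exists_lang_eq_mul (A₁ A₂ : VRA I C R) :
    ∃ B : VRA I C R, B.lang = A₁.lang * A₂.lang ∧ B.size ≤ 4 * (A₁.size + A₂.size) := by
  -- The hub of the concatenation is one additional state, which is too much if both sizes are `0`.
  obtain h₀ | h₀ := Nat.eq_zero_or_pos (A₁.size + A₂.size)
  · refine ⟨A₁, ?_, by omega⟩
    rw [lang_eq_zero_of_size_eq_zero (Nat.add_eq_zero_iff.1 h₀).1, zero_mul]
  let A : Bool → VRA I C R := fun b => cond b A₁ A₂
  refine ⟨withStart A ((familyStart A true).concat (familyStart A false)), ?_, ?_⟩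
  · rw [lang_withStart, NFA.accepts_concat]
    exact (substLang_mul _ _).trans (congrArg₂ (· * ·)
      (substLang_accepts_familyStart true) (substLang_accepts_familyStart false))
  · have h₁ : _ ≤ A₁.size := card_familyStart_add_ncard_le A true
    have h₂ : _ ≤ A₂.size := card_familyStart_add_ncard_le A false
    have ht := NFA.ncard_transSet_concat_le (M := familyStart A true) (N := familyStart A false)
    refine size_withStart_le.trans ?_
    rw [Fintype.sum_bool, Nat.card_sum, Finite.card_option]
    change _ + (A₁.size + A₂.size) ≤ _
    omega

theorem exists_lang_eq_kstar (A₁ : VRA I C R) :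
    ∃ B : VRA I C R, B.lang = A₁.lang∗ ∧ B.size ≤ 6 * max 1 A₁.size := by
  let A : Unit → VRA I C R := fun _ => A₁
  refine ⟨withStart A (familyStart A ()).star, ?_, ?_⟩
  · rw [lang_withStart, NFA.accepts_star]
    exact (substLang_kstar _).trans (congrArg _ (substLang_accepts_familyStart ()))
  · have h : _ ≤ A₁.size := card_familyStart_add_ncard_le A ()
    have ht := NFA.ncard_transSet_star_le (M := familyStart A ())
    refine size_withStart_le.trans ?_
    rw [Fintype.sum_unique, Finite.card_option]
    change _ + A₁.size ≤ _
    omega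

theorem exists_lang_eq_sup (A₁ A₂ : VRA I C R) :
    ∃ B : VRA I C R, B.lang = A₁.lang ⊔ A₂.lang ∧ B.size ≤ 2 * (A₁.size + A₂.size) := by
  let A : Bool → VRA I C R := fun b => cond b A₁ A₂
  refine ⟨withStart A ((familyStart A true).union (familyStart A false)), ?_, ?_⟩
  · rw [lang_withStart, NFA.accepts_union]
    exact (substLang_add _ _).trans (congrArg₂ (· + ·)
      (substLang_accepts_familyStart true) (substLang_accepts_familyStart false))
  · have h₁ : _ ≤ A₁.size := card_familyStart_add_ncard_le A true
    have h₂ : _ ≤ A₂.size := card_familyStart_add_ncard_le A false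
    have ht := NFA.ncard_transSet_union_le (M := familyStart A true) (N := familyStart A false)
    refine size_withStart_le.trans ?_
    rw [Fintype.sum_bool, Nat.card_sum]
    change _ + (A₁.size + A₂.size) ≤ _
    omega

end VRA

theorem mainTheorem2 :
    (∃ K : ℕ, ∀ (I C R : Type u) [Finite I] [Finite C] [Finite R] (A₁ A₂ : VRA I C R),
      (∃ B : VRA I C R, B.lang = A₁.lang * A₂.lang ∧ B.size ≤ K * (A₁.size + A₂.size)) ∧
      (∃ B : VRA I C R, B.lang = A₁.lang∗ ∧ B.size ≤ K * max 1 A₁.size) ∧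
      (∃ B : VRA I C R, B.lang = A₁.lang ⊔ A₂.lang ∧ B.size ≤ K * (A₁.size + A₂.size)) ∧
      (∃ B : VRA I C R, B.lang = A₁.lang ⊓ A₂.lang ∧ B.size ≤ K * (A₁.size * A₂.size))) ∧
    (∀ (I C R : Type u) [Finite I] [Finite C] [Finite R], ∃ K : ℕ, ∀ A₁ : VRA I C R,
      ∃ D B : VRA I C R,
        (D.lang = A₁.lang ∧ D.Codeterministic ∧ D.Complete ∧ D.AllDFA) ∧
        B = D.flipStart ∧
        B.lang = WM I C R \ A₁.lang ∧ B.size ≤ 2 ^ (K * max 1 A₁.size)) := by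
  refine ⟨⟨6, fun I C R _ _ _ A₁ A₂ => ⟨?_, A₁.exists_lang_eq_kstar, ?_, ?_⟩⟩,
    fun I C R _ _ _ => ⟨2 * Nat.card (C × R) + Nat.card I + 3, fun A => ?_⟩⟩
  · obtain ⟨B, hB, h⟩ := A₁.exists_lang_eq_mul A₂
    exact ⟨B, hB, h.trans (by omega)⟩
  · obtain ⟨B, hB, h⟩ := A₁.exists_lang_eq_sup A₂
    exact ⟨B, hB, h.trans (by omega)⟩
  · exact ⟨A₁.inter A₂, VRA.lang_inter, VRA.size_inter_le.trans (by omega)⟩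
  · exact ⟨A.determinize, A.determinize.flipStart,
      ⟨VRA.lang_determinize, VRA.codeterministic_determinize, VRA.complete_determinize,
        VRA.allDFA_determinize⟩, rfl, VRA.lang_flipStart_determinize,
      VRA.size_flipStart.trans_le A.size_determinize_le⟩
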